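/- Fix $d$. Let $P_1,P_2\in\mathbb R^{d\times d}$ and $Q\in\mathbb R^{2d\times 2d}$ be symmetric positive semidefinite, let $H=\begin{bmatrix} I_d\\ I_d\end{bmatrix}$, and let $\preceq$ be the Loewner order. Define the admissible set $$\mathcal A_{\mathrm{ESCI}}=\Big\{\begin{bmatrix}P_1&X\\X^{\top}&P_2\end{bmatrix}+Q \;:\; X\in\mathbb R^{d\times d},\ \begin{bmatrix}P_1&X\\X^{\top}&P_2\end{bmatrix}\succeq 0\Big\}.$$ A conservative fusion is a pair $(K,B_F)$ with $K\in\mathbb R^{d\times 2d}$, $KH=I_d$, $B_F\in\mathbb R^{d\times d}$ symmetric, $B_F\succeq0$, and $KRK^{\top}\preceq B_F$ for all $R\in\mathcal A_{\mathrm{ESCI}}$; such a $B_F$ is called a conservative bound. For $\omega=(\omega_1,\omega_2)$ in the unit simplex $\mathcal K^2=\{\omega_1,\omega_2\ge0,\ \omega_1+\omega_2=1\}$ with $\omega_1,\omega_2>0$, put $B_c(\omega)=\operatorname{diag}(P_1/\omega_1,P_2/\omega_2)+Q$ and $$B_F^{\mathrm{ESCI}}(\omega)=\big(H^{\top}B_c(\omega)^{-1}H\big)^{-1},$$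 to be read, if $B_c(\omega)$ is singular, as $\lim_{\varepsilon\downarrow0}\big(H^{\top}(B_c(\omega)+\varepsilon I_{2d})^{-1}H\big)^{-1}$. Extend $B_F^{\mathrm{ESCI}}$ to the two endpoints of $\mathcal K^2$ by continuity (these limits exist). Let $J$ be a real-valued cost function that is strictly increasing on the set of conservative bounds: $J(A)<J(B)$ whenever $A,B$ are conservative bounds with $A\preceq B$ and $A\ne B$. Let $(K,B_F)$ be a conservative fusion. Then $(K,B_F)$ minimizes $J(B_F')$ over all conservative fusions $(K',B_F')$ if and only if there is $\omega^*\in\mathcal K^2$ that minimizes $\omega\mapsto J(B_F^{\mathrm{ESCI}}(\omega))$ over $\mathcal K^2$ and satisfies $B_F=B_F^{\mathrm{ESCI}}(\omega^*)$. -/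

import Mathlib

open scoped Topology MatrixOrder

noncomputable section

namespace ESCI

variable {N d : ℕ}

/-- Centralized `Nd × Nd` real matrices. The index `(a, i)` is the coordinate `a` of the error of
the estimator `i`. -/
abbrev CentMatrix (N d : ℕ) : Type := Matrix (Fin d × Fin N) (Fin d × Fin N) ℝ

/-- Fusion gains `K = [K₁ ⋯ K_N]`, of size `d × Nd`. -/
abbrev Gain (N d : ℕ) : Type := Matrix (Fin d) (Fin d × Fin N) ℝ

/-- The centralized observation matrix `H`, of size `Nd × d`: `N` identity matrices stacked. -/
def obs (N d : ℕ) : Matrix (Fin d × Fin N) (Fin d) ℝ :=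
  Matrix.of fun p b => (1 : Matrix (Fin d) (Fin d) ℝ) p.1 b

/-- The admissible set: all `P₁ + Q` where `P₁ ⪰ 0` has the prescribed diagonal blocks `P i`
(the cross-covariances being free), and `Q` is the known covariance of the second components. -/
def admissible (P : Fin N → Matrix (Fin d) (Fin d) ℝ) (Q : CentMatrix N d) :
    Set (CentMatrix N d) :=
  {R | ∃ P₁ : CentMatrix N d,
    P₁.PosSemidef ∧ (∀ i, P₁.blockDiag i = P i) ∧ R = P₁ + Q}

/-- `B` is a conservative upper bound, over the set `A` of admissible covariances, for the linear
fusion of unbiased gain `K`. The relation `≤` is the Loewner order. -/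
structure IsConservative (A : Set (CentMatrix N d)) (K : Gain N d)
    (B : Matrix (Fin d) (Fin d) ℝ) : Prop where
  unbiased : K * obs N d = 1
  posSemidef : B.PosSemidef
  le : ∀ R ∈ A, K * R * K.transpose ≤ B

/-- The matrices which are a conservative upper bound for some unbiased linear fusion. -/
def conservativeBounds (A : Set (CentMatrix N d)) : Set (Matrix (Fin d) (Fin d) ℝ) :=
  {B | ∃ K, IsConservative A K B}

/-- `(K, B)` solves the optimal conservative fusion problem: it minimizes the cost `J` of the bound
among all the conservative fusions. -/
def IsOptimal (J : Matrix (Fin d) (Fin d) ℝ → ℝ) (A : Set (CentMatrix N d)) (K : Gain N d)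
    (B : Matrix (Fin d) (Fin d) ℝ) : Prop :=
  IsConservative A K B ∧ ∀ K' B', IsConservative A K' B' → J B ≤ J B'

/-- The formula `(Hᵀ C⁻¹ H)⁻¹`, for an invertible `C`. -/
def fusedFormula (C : CentMatrix N d) : Matrix (Fin d) (Fin d) ℝ :=
  ((obs N d).transpose * C⁻¹ * obs N d)⁻¹

open scoped Classical in
/-- The fused bound associated with a centralized bound `C ⪰ 0`: it is `(Hᵀ C⁻¹ H)⁻¹` if `C ≻ 0`,
and the limit of `(Hᵀ (C + ε I)⁻¹ H)⁻¹` as `ε` decreases to `0` if `C` is singular. -/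
def fusedBound (C : CentMatrix N d) : Matrix (Fin d) (Fin d) ℝ :=
  if C.PosDef then fusedFormula C
  else Filter.limUnder (𝓝[>] (0 : ℝ)) fun ε => fusedFormula (C + ε • (1 : CentMatrix N d))

/-- The centralized bound `diag(P₁ / ω₁, …, P_N / ω_N) + Q`, for positive weights. -/
def centBound (P : Fin N → Matrix (Fin d) (Fin d) ℝ) (Q : CentMatrix N d) (ω : Fin N → ℝ) :
    CentMatrix N d :=
  Matrix.blockDiagonal (fun i => (1 / ω i) • P i) + Q

/-- The interior of the unit simplex of `ℝ^N`: the weights that are all positive. -/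
def simplexInterior (N : ℕ) : Set (Fin N → ℝ) :=
  {ω | ω ∈ stdSimplex ℝ (Fin N) ∧ ∀ i, 0 < ω i}

open scoped Classical in
/-- The bound of the extended split covariance intersection, for the weights `ω` in the unit
simplex. It is the fused bound associated with `centBound P Q ω` if all weights are positive, and it
is extended by continuity to the boundary of the simplex. -/
def esciBound (P : Fin N → Matrix (Fin d) (Fin d) ℝ) (Q : CentMatrix N d) (ω : Fin N → ℝ) :
    Matrix (Fin d) (Fin d) ℝ :=
  if ω ∈ simplexInterior N then fusedBound (centBound P Q ω)
  else Filter.limUnder (𝓝[simplexInterior N] ω) fun ω' => fusedBound (centBound P Q ω')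

end ESCI

end

/-!
The bounds `esciBound P Q ω` are conservative, and every conservative bound dominates one of them
in the Loewner order. As the cost is strictly increasing on the conservative bounds, minimizing it
over all the conservative fusions then amounts to minimizing it over the weights, and a minimizer
cannot be strictly above the fused bound that it dominates.

The fused bounds are understood through their variational characterization: `fusedBound C` is the
least element of `{K C Kᵀ | K H = 1}` (`isLeast_fusedBound`), also for a singular `C`. At the vertex
`i` of the simplex, `esciBound` is the least `K (diag(P i) + Q) Kᵀ` under the additional constraint
that `K` annihilates the block `P j` of the other estimator (`isLeast_esciBound_vertex`). The minima
are attained because the stationarity conditions of a convex quadratic problem with linear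
constraints are always solvable (`exists_stationary`), and their Lagrange multipliers give the
estimates from below that identify the limits (`le_of_stationary`, `sub_smul_le_of_stationary`).
Conservativeness follows from `R ≤ centBound P Q ω` for `R` admissible (`admissible_le_centBound`).

For the domination (`exists_esciBound_le`), let `K` and `B` be a conservative fusion. Write
`k = Kᵀ x` and let `T₀`, `T₁` be the two diagonal blocks of `P`. Admissible covariances with
rank-one cross-covariances show that
`k ⬝ T₀ k + k ⬝ T₁ k + k ⬝ Q k + 2 k ⬝ T₀ y ≤ x ⬝ B x` whenever `y ⬝ T₀ y ≤ k ⬝ T₁ k`.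
The S-lemma (`exists_nonneg_add_mul_nonpos`) turns this into one inequality with a multiplier `μ`
valid for all `x` and `y`, and maximizing over `y` leaves
`(1 + 1 / μ) k ⬝ T₀ k + (1 + μ) k ⬝ T₁ k + k ⬝ Q k ≤ x ⬝ B x`, that is `K (centBound P Q ω) Kᵀ ≤ B`
with weights `ω = (μ, 1) / (1 + μ)`. The degenerate cases, in which `K` annihilates one of the
blocks, lead to the vertices.
-/

namespace ESCI

open Matrix Filter

variable {m n p V : Type*}

/-! ### Real positive semidefinite matrices and the Loewner order -/

theorem transpose_eq_of_posSemidef {A : Matrix n n ℝ} (hA : A.PosSemidef) : Aᵀ = A := by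
  simpa using hA.1.eq

theorem dotProduct_mulVec_self_nonneg [Fintype n] {A : Matrix n n ℝ} (hA : A.PosSemidef)
    (x : n → ℝ) : 0 ≤ x ⬝ᵥ A *ᵥ x := by
  have := hA.dotProduct_mulVec_nonneg x
  rwa [star_trivial] at this

theorem dotProduct_mulVec_comm [Fintype n] {A : Matrix n n ℝ} (hA : A.PosSemidef)
    (x y : n → ℝ) : x ⬝ᵥ A *ᵥ y = y ⬝ᵥ A *ᵥ x := by
  rw [dotProduct_mulVec, ← mulVec_transpose, transpose_eq_of_posSemidef hA, dotProduct_comm]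

theorem abs_apply_le_of_posSemidef [Fintype n] {A : Matrix n n ℝ} (hA : A.PosSemidef) (i j : n) :
    |A i j| ≤ (A i i + A j j) / 2 := by
  classical
  have hs : A j i = A i j := by simpa using hA.1.apply i j
  have h₁ := hA.dotProduct_mulVec_nonneg (Pi.single i 1 + Pi.single j 1)
  have h₂ := hA.dotProduct_mulVec_nonneg (Pi.single i 1 - Pi.single j 1)
  simp [mulVec_add, mulVec_sub, add_dotProduct, sub_dotProduct] at h₁ h₂
  rw [abs_le]
  constructor <;> linarith

/-- The squeeze theorem for the Loewner order: the entries of a positive semidefinite matrix are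
controlled by its diagonal. -/
theorem tendsto_of_le_of_le [Fintype n] {ι : Type*} {l : Filter ι} {f g h : ι → Matrix n n ℝ}
    {L : Matrix n n ℝ} (hg : Tendsto g l (𝓝 L)) (hh : Tendsto h l (𝓝 L))
    (hgf : ∀ᶠ t in l, g t ≤ f t) (hfh : ∀ᶠ t in l, f t ≤ h t) : Tendsto f l (𝓝 L) := by
  have hd : Tendsto (fun t => h t - g t) l (𝓝 0) := by simpa using hh.sub hg
  have hfg : Tendsto (fun t => f t - g t) l (𝓝 0) := by
    refine tendsto_pi_nhds.2 fun i => tendsto_pi_nhds.2 fun j => ?_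
    have hdiag : ∀ k, Tendsto (fun t => (h t - g t) k k) l (𝓝 0) := fun k =>
      tendsto_pi_nhds.1 (tendsto_pi_nhds.1 hd k) k
    have hb : Tendsto (fun t => ((h t - g t) i i + (h t - g t) j j) / 2) l (𝓝 0) := by
      simpa using ((hdiag i).add (hdiag j)).div_const 2
    refine squeeze_zero_norm' ?_ hb
    filter_upwards [hgf, hfh] with t h₁ h₂
    have h₃ := abs_apply_le_of_posSemidef (Matrix.le_iff.1 h₁) i j
    have h₄ : ∀ k, f t k k ≤ h t k k := fun k => by
      have := (Matrix.le_iff.1 h₂).diag_nonneg (i := k)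
      simpa using this
    have := h₄ i
    have := h₄ j
    rw [Real.norm_eq_abs]
    refine h₃.trans ?_
    simp only [Matrix.sub_apply]
    linarith
  simpa using hfg.add hg

theorem le_iff_dotProduct_mulVec_le [Fintype n] {A B : Matrix n n ℝ} (hA : A.IsHermitian)
    (hB : B.IsHermitian) : A ≤ B ↔ ∀ x, x ⬝ᵥ A *ᵥ x ≤ x ⬝ᵥ B *ᵥ x := by
  rw [Matrix.le_iff, posSemidef_iff_dotProduct_mulVec, and_iff_right (hB.sub hA)]
  simp [sub_mulVec]

theorem le_of_tendsto_of_le [Fintype n] {ι : Type*} {l : Filter ι} [l.NeBot]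
    {f : ι → Matrix n n ℝ} {A L : Matrix n n ℝ} (hA : A.IsHermitian) (hL : L.IsHermitian)
    (hf : Tendsto f l (𝓝 L)) (h : ∀ᶠ t in l, A ≤ f t) : A ≤ L := by
  refine (le_iff_dotProduct_mulVec_le hA hL).2 fun x => ?_
  have hc : Continuous fun M : Matrix n n ℝ => x ⬝ᵥ M *ᵥ x := by fun_prop
  refine ge_of_tendsto ((hc.tendsto L).comp hf) ?_
  filter_upwards [h] with t ht
  have := dotProduct_mulVec_self_nonneg (Matrix.le_iff.1 ht) x
  simpa [sub_mulVec] using this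

theorem mul_mul_transpose_le [Finite m] [Fintype n] {A B : Matrix n n ℝ} (h : A ≤ B)
    (K : Matrix m n ℝ) :
    K * A * Kᵀ ≤ K * B * Kᵀ := by
  have := (Matrix.le_iff.1 h).mul_mul_conjTranspose_same K
  rw [Matrix.le_iff]
  simpa [Matrix.mul_sub, Matrix.sub_mul] using this

theorem posSemidef_mul_mul_transpose [Finite m] [Fintype n] {A : Matrix n n ℝ} (hA : A.PosSemidef)
    (K : Matrix m n ℝ) : (K * A * Kᵀ).PosSemidef := by
  simpa using hA.mul_mul_conjTranspose_same K

/-! ### Quadratic minimization under linear constraints -/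

/-- The range of a symmetric matrix is the orthogonal complement of its kernel. -/
theorem exists_mulVec_eq_of_isSymm [Fintype n] {M : Matrix n n ℝ} (hM : M.IsSymm) {b : n → ℝ}
    (hb : ∀ v, M *ᵥ v = 0 → b ⬝ᵥ v = 0) : ∃ x, M *ᵥ x = b := by
  classical
  by_contra hx
  have hmem : b ∉ LinearMap.range M.mulVecLin := by
    rintro ⟨x, hx'⟩
    exact hx ⟨x, hx'⟩
  obtain ⟨f, hfb, hf⟩ := Submodule.exists_le_ker_of_notMem hmem
  obtain ⟨v, rfl⟩ := (dotProductEquiv ℝ n).surjective f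
  refine hfb ?_
  have hv : M *ᵥ v = 0 := by
    refine dotProduct_eq_zero _ fun w => ?_
    have : v ⬝ᵥ M *ᵥ w = 0 := by
      simpa using hf (LinearMap.mem_range_self M.mulVecLin w)
    rwa [dotProduct_mulVec, ← mulVec_transpose, hM.eq] at this
  simpa [dotProduct_comm] using hb v hv

/-- Solvability of the stationarity conditions for minimizing `k ⬝ᵥ D *ᵥ k` under the constraint
that `k ᵥ* A = k₀ ᵥ* A`, where `l` is the Lagrange multiplier. They form a symmetric linear system
whose right-hand side is orthogonal to the kernel, even if `D` is singular or `A` has dependent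
columns. -/
theorem exists_stationary_vec [Fintype m] [Fintype n] {D : Matrix n n ℝ} (hD : D.PosSemidef)
    (A : Matrix n m ℝ) (k₀ : n → ℝ) : ∃ k l, k ᵥ* A = k₀ ᵥ* A ∧ D *ᵥ k = A *ᵥ l := by
  have hDs : Dᵀ = D := transpose_eq_of_posSemidef hD
  obtain ⟨x, hx⟩ := exists_mulVec_eq_of_isSymm (M := fromBlocks D A Aᵀ 0)
    (b := Sum.elim 0 (k₀ ᵥ* A)) (by simp [IsSymm, fromBlocks_transpose, hDs]) (by
      intro v hv
      obtain ⟨z, l, rfl⟩ : ∃ z l, v = Sum.elim z l := ⟨v ∘ Sum.inl, v ∘ Sum.inr, by simp⟩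
      rw [fromBlocks_mulVec] at hv
      have h₁ : D *ᵥ z + A *ᵥ l = 0 := by
        funext i; simpa using congrFun hv (Sum.inl i)
      have h₂ : z ᵥ* A = 0 := by
        funext i; simpa [mulVec_transpose] using congrFun hv (Sum.inr i)
      have h₃ : z ⬝ᵥ D *ᵥ z = 0 := by
        have := congrArg (z ⬝ᵥ ·) h₁
        simpa [dotProduct_add, dotProduct_mulVec z A, h₂] using this
      have h₄ : D *ᵥ z = 0 := (hD.dotProduct_mulVec_zero_iff z).1 (by simpa using h₃)
      have h₅ : A *ᵥ l = 0 := by simpa [h₄] using h₁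
      rw [sumElim_dotProduct_sumElim, ← dotProduct_mulVec, h₅]
      simp)
  obtain ⟨k, l, rfl⟩ : ∃ z l, x = Sum.elim z l := ⟨x ∘ Sum.inl, x ∘ Sum.inr, by simp⟩
  rw [fromBlocks_mulVec] at hx
  refine ⟨k, -l, ?_, ?_⟩
  · funext i; simpa [mulVec_transpose] using congrFun hx (Sum.inr i)
  · funext i
    have := congrFun hx (Sum.inl i)
    simp [mulVec_neg] at this ⊢
    linarith

/-- A gain `K` that is stationary for `K * D * Kᵀ` under the constraint `K * A = K₀ * A`; the rows
are independent instances of `exists_stationary_vec`. -/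
theorem exists_stationary [Fintype m] [Fintype n] {D : Matrix n n ℝ} (hD : D.PosSemidef)
    (A : Matrix n m ℝ) (K₀ : Matrix p n ℝ) :
    ∃ (K : Matrix p n ℝ) (L : Matrix m p ℝ), K * A = K₀ * A ∧ D * Kᵀ = A * L := by
  choose k l hk hl using fun i => exists_stationary_vec hD A (K₀ i)
  refine ⟨of k, (of l)ᵀ, ?_, ?_⟩
  · ext i j
    simpa [vecMul, mul_apply, dotProduct] using congrFun (hk i) j
  · ext i j
    simpa [mulVec, mul_apply, dotProduct] using congrFun (hl j) i

/-- A stationary gain minimizes `K * D * Kᵀ` in the Loewner order among the gains satisfying the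
same constraint: the cross terms of `K' = K + (K' - K)` vanish. -/
theorem le_of_stationary [Fintype m] [Fintype n] [Finite p] {D : Matrix n n ℝ}
    (hD : D.PosSemidef) {A : Matrix n m ℝ} {K K' : Matrix p n ℝ} {L : Matrix m p ℝ}
    (hK : D * Kᵀ = A * L) (hKK' : K' * A = K * A) : K * D * Kᵀ ≤ K' * D * K'ᵀ := by
  have hDs : Dᵀ = D := transpose_eq_of_posSemidef hD
  have h₁ : K' * D * Kᵀ = K * D * Kᵀ := by
    rw [Matrix.mul_assoc, Matrix.mul_assoc, hK, ← Matrix.mul_assoc, ← Matrix.mul_assoc, hKK']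
  have h₂ : K * D * K'ᵀ = K * D * Kᵀ := by
    have := congrArg Matrix.transpose h₁
    simpa [Matrix.transpose_mul, hDs, Matrix.mul_assoc] using this
  have key := posSemidef_mul_mul_transpose hD (K' - K)
  rw [Matrix.transpose_sub, Matrix.mul_sub, Matrix.sub_mul, Matrix.sub_mul, Matrix.sub_mul, h₁, h₂,
    sub_self, sub_zero] at key
  rwa [Matrix.le_iff]

/-- Quantitative form of the penalty method. If `K` is stationary for `D` under the constraints
`K * A = K' * A` and `K * T = 0`, the latter with multiplier `M`, then replacing the constraint
`K * T = 0` by the penalty `T / t` lowers the minimum by at most `t • (Mᵀ * T * M)`. -/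
theorem sub_smul_le_of_stationary [Fintype m] [Fintype n] [Finite p]
    {D T : Matrix n n ℝ} (hD : D.PosSemidef) (hT : T.PosSemidef)
    {A : Matrix n m ℝ} {K K' : Matrix p n ℝ} {L : Matrix m p ℝ} {M : Matrix n p ℝ}
    (hK : D * Kᵀ = A * L + T * M) (hKK' : K' * A = K * A) (hKT : K * T = 0) {t : ℝ} (ht : 0 < t) :
    K * D * Kᵀ - t • (Mᵀ * T * M) ≤ K' * (D + (1 / t) • T) * K'ᵀ := by
  obtain ⟨X, rfl⟩ : ∃ X, K' = K + X := ⟨K' - K, by simp⟩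
  have hXA : X * A = 0 := by simpa [Matrix.add_mul] using hKK'
  have hDs : Dᵀ = D := transpose_eq_of_posSemidef hD
  have hTs : Tᵀ = T := transpose_eq_of_posSemidef hT
  have h₁ : X * D * Kᵀ = X * T * M := by
    rw [Matrix.mul_assoc, hK, Matrix.mul_add, ← Matrix.mul_assoc, hXA, Matrix.zero_mul, zero_add,
      Matrix.mul_assoc]
  have h₂ : K * D * Xᵀ = Mᵀ * T * Xᵀ := by
    have := congrArg Matrix.transpose h₁
    simpa [Matrix.transpose_mul, hDs, hTs, Matrix.mul_assoc] using this
  have h₃ : T * Kᵀ = 0 := by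
    have := congrArg Matrix.transpose hKT
    simpa [Matrix.transpose_mul, hTs] using this
  have key := (posSemidef_mul_mul_transpose hD X).add
    ((posSemidef_mul_mul_transpose hT (X + t • Mᵀ)).smul (one_div_nonneg.2 ht.le))
  rw [Matrix.le_iff]
  have e : (K + X) * (D + (1 / t) • T) * (K + X)ᵀ - (K * D * Kᵀ - t • (Mᵀ * T * M)) =
      X * D * Xᵀ + (1 / t) • ((X + t • Mᵀ) * T * (X + t • Mᵀ)ᵀ) := by
    simp only [Matrix.transpose_add, Matrix.transpose_smul, Matrix.transpose_transpose,
      Matrix.add_mul, Matrix.mul_add, Matrix.smul_mul, Matrix.mul_smul, smul_add, h₁, h₂, hKT,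
      Matrix.zero_mul, Matrix.mul_assoc X T, h₃, Matrix.mul_zero, smul_zero, smul_smul]
    rw [one_div, inv_mul_cancel₀ ht.ne', inv_mul_cancel_left₀ ht.ne', one_smul, one_smul]
    abel
  rw [e]
  exact key

/-! ### The S-lemma -/

/-- The homogeneous S-lemma, for two quadratic forms on a real vector space of any dimension: if
`q₁ ≤ 0` wherever `0 ≤ q₂`, and `q₂` takes a positive value, then some `q₁ + μ q₂` with `0 ≤ μ` is
nonpositive everywhere. -/
theorem exists_nonneg_add_mul_nonpos [AddCommGroup V] [Module ℝ V] (q₁ q₂ : QuadraticForm ℝ V)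
    (h : ∀ z, 0 ≤ q₂ z → q₁ z ≤ 0) (hpos : ∃ z, 0 < q₂ z) :
    ∃ μ : ℝ, 0 ≤ μ ∧ ∀ z, q₁ z + μ * q₂ z ≤ 0 := by
  have expand : ∀ (q : QuadraticForm ℝ V) (z w : V) (t : ℝ),
      q (z + t • w) = q z + t * QuadraticMap.polar q z w + t * t * q w := by
    intro q z w t
    rw [QuadraticMap.map_add q, QuadraticMap.map_smul, QuadraticMap.polar_smul_right]
    simp only [smul_eq_mul]
    ring
  -- The multiplier must satisfy `q₁ w / (-q₂ w) ≤ μ` if `q₂ w < 0` and `μ ≤ -q₁ z / q₂ z` if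
  -- `0 < q₂ z`; these bounds are compatible because `q₂` vanishes at two points `z + t • w`, with
  -- parameters of opposite signs, and `q₁ ≤ 0` at both.
  have cross : ∀ z w, 0 < q₂ z → q₂ w < 0 → q₁ w / (-q₂ w) ≤ -q₁ z / q₂ z := by
    intro z w hz hw
    set a := q₂ z
    set b := -q₂ w
    have hb : 0 < b := by simp only [b]; linarith
    set β := QuadraticMap.polar q₂ z w
    set γ := QuadraticMap.polar q₁ z w
    have hdisc : 0 < β ^ 2 + 4 * a * b := by positivity
    set s := √(β ^ 2 + 4 * a * b)
    have hs : s ^ 2 = β ^ 2 + 4 * a * b := Real.sq_sqrt hdisc.le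
    have hs0 : 0 < s := Real.sqrt_pos.2 hdisc
    have hβs : |β| < s := abs_lt_of_sq_lt_sq (by nlinarith [mul_pos hz hb]) hs0.le
    obtain ⟨hβ₁, hβ₂⟩ := abs_lt.1 hβs
    have key : ∀ t : ℝ, b * t ^ 2 = a + β * t → q₁ z + t * γ + t * t * q₁ w ≤ 0 := by
      intro t ht
      rw [← expand]
      refine h _ ?_
      rw [expand]
      simp only [b] at ht
      change 0 ≤ a + t * β + _
      nlinarith
    have h₁ := key ((β + s) / (2 * b)) (by field_simp; nlinarith)
    have h₂ := key ((β - s) / (2 * b)) (by field_simp; nlinarith)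
    rw [div_le_div_iff₀ hb hz]
    have e₁ : q₁ z * (4 * b ^ 2) + 2 * b * (β + s) * γ + (β + s) ^ 2 * q₁ w ≤ 0 := by
      have := mul_nonpos_of_nonneg_of_nonpos (show 0 ≤ 4 * b ^ 2 by positivity) h₁
      field_simp at this
      nlinarith
    have e₂ : q₁ z * (4 * b ^ 2) + 2 * b * (β - s) * γ + (β - s) ^ 2 * q₁ w ≤ 0 := by
      have := mul_nonpos_of_nonneg_of_nonpos (show 0 ≤ 4 * b ^ 2 by positivity) h₂
      field_simp at this
      nlinarith
    -- Combining the two inequalities with weights `s - β` and `s + β` cancels the polar term `γ`.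
    have e₃ := add_nonpos (mul_nonpos_of_nonneg_of_nonpos (show 0 ≤ s - β by linarith) e₁)
      (mul_nonpos_of_nonneg_of_nonpos (show 0 ≤ s + β by linarith) e₂)
    have e₄ : 8 * b ^ 2 * s * q₁ z + (s ^ 2 - β ^ 2) * (2 * s) * q₁ w ≤ 0 := by
      nlinarith
    rw [hs] at e₄
    have e₅ : (8 * b * s) * (q₁ w * a + q₁ z * b) ≤ 0 := by nlinarith
    have := nonpos_of_mul_nonpos_right e₅ (by positivity)
    linarith
  obtain ⟨z₀, hz₀⟩ := hpos
  -- The value `0` is inserted so that the supremum is nonnegative, also if `q₂` is never negative.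
  let S : Set ℝ := insert 0 {r | ∃ w, q₂ w < 0 ∧ r = q₁ w / (-q₂ w)}
  have hS : ∀ z, 0 < q₂ z → ∀ r ∈ S, r ≤ -q₁ z / q₂ z := by
    rintro z hz r (rfl | ⟨w, hw, rfl⟩)
    · exact div_nonneg (by linarith [h z hz.le]) hz.le
    · exact cross z w hz hw
  have hbdd : BddAbove S := ⟨_, hS z₀ hz₀⟩
  refine ⟨sSup S, le_csSup hbdd (Set.mem_insert _ _), fun z => ?_⟩
  rcases lt_trichotomy (q₂ z) 0 with hz | hz | hz
  · have := le_csSup hbdd (Set.mem_insert_of_mem 0 ⟨z, hz, rfl⟩ : q₁ z / (-q₂ z) ∈ S)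
    rw [div_le_iff₀ (by linarith)] at this
    linarith
  · simpa [hz] using h z hz.ge
  · have : sSup S ≤ _ := csSup_le ⟨0, Set.mem_insert _ _⟩ (hS z hz)
    rw [le_div_iff₀ hz] at this
    linarith

/-! ### Fused bounds as Loewner minima -/

variable {N d : ℕ}

/-- The covariances `K * C * Kᵀ` of the errors fused by unbiased gains `K`, for a centralized
covariance `C`. -/
def fusionCovariances (C : CentMatrix N d) : Set (Matrix (Fin d) (Fin d) ℝ) :=
  {F | ∃ K : Gain N d, K * obs N d = 1 ∧ F = K * C * Kᵀ}

/-- The unbiased gain that returns the estimate `i` and ignores all the others. -/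
def selection (d : ℕ) (i : Fin N) : Gain N d :=
  Matrix.of fun a p => if p.2 = i then (1 : Matrix (Fin d) (Fin d) ℝ) a p.1 else 0

theorem selection_mul_obs (i : Fin N) : selection d i * obs N d = 1 := by
  ext a b
  simp [selection, obs, mul_apply, Fintype.sum_prod_type, Matrix.one_apply]

/-- The Gauss–Markov theorem: `(Hᵀ C⁻¹ H)⁻¹` is the least fused covariance, attained by the gain
`(Hᵀ C⁻¹ H)⁻¹ Hᵀ C⁻¹`. -/
theorem isLeast_fusedFormula [NeZero N] {C : CentMatrix N d} (hC : C.PosDef) :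
    IsLeast (fusionCovariances C) (fusedFormula C) := by
  set H := obs N d with hH
  have hinj : Function.Injective H.mulVec := by
    refine Function.LeftInverse.injective (g := (selection d (0 : Fin N)).mulVec) fun x => ?_
    rw [mulVec_mulVec, selection_mul_obs, one_mulVec]
  have hS : (Hᵀ * C⁻¹ * H).PosDef := by
    simpa using hC.inv.conjTranspose_mul_mul_same hinj
  have hSu : IsUnit (Hᵀ * C⁻¹ * H).det := (Matrix.isUnit_iff_isUnit_det _).1 hS.isUnit
  have hCu : IsUnit C.det := (Matrix.isUnit_iff_isUnit_det _).1 hC.isUnit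
  have hSs : ((Hᵀ * C⁻¹ * H)⁻¹)ᵀ = (Hᵀ * C⁻¹ * H)⁻¹ := by simpa using hS.inv.1.eq
  have hCs : (C⁻¹)ᵀ = C⁻¹ := by simpa using hC.inv.1.eq
  set F := (Hᵀ * C⁻¹ * H)⁻¹ with hF
  have hKH : (F * Hᵀ * C⁻¹) * H = 1 := by
    rw [Matrix.mul_assoc, Matrix.mul_assoc, ← Matrix.mul_assoc Hᵀ, hF, Matrix.nonsing_inv_mul _ hSu]
  have hst : C * (F * Hᵀ * C⁻¹)ᵀ = H * F := by
    simp only [Matrix.transpose_mul, hSs, hCs, Matrix.transpose_transpose]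
    rw [← Matrix.mul_assoc, Matrix.mul_nonsing_inv _ hCu, Matrix.one_mul]
  have hval : F = (F * Hᵀ * C⁻¹) * C * (F * Hᵀ * C⁻¹)ᵀ := by
    rw [Matrix.mul_assoc, hst, ← Matrix.mul_assoc, hKH, Matrix.one_mul]
  refine ⟨⟨_, hKH, hval⟩, ?_⟩
  rintro _ ⟨K', hK', rfl⟩
  change F ≤ _
  rw [hval]
  exact le_of_stationary hC.posSemidef hst (hK'.trans hKH.symm)

/-- For a singular `C` too, the regularized limit in `fusedBound` exists and is the least fused
covariance: the formula for `C + ε I` lies between the minimum `K * C * Kᵀ` and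
`K * (C + ε I) * Kᵀ`, where `K` is a minimizer for `C`. -/
theorem isLeast_fusedBound [NeZero N] {C : CentMatrix N d} (hC : C.PosSemidef) :
    IsLeast (fusionCovariances C) (fusedBound C) := by
  by_cases hpd : C.PosDef
  · simpa [fusedBound, hpd] using isLeast_fusedFormula hpd
  obtain ⟨K, L, hK, hst⟩ := exists_stationary hC (obs N d) (selection d (0 : Fin N))
  rw [selection_mul_obs] at hK
  have hleast : IsLeast (fusionCovariances C) (K * C * Kᵀ) := by
    refine ⟨⟨K, hK, rfl⟩, ?_⟩
    rintro _ ⟨K', hK', rfl⟩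
    exact le_of_stationary hC hst (hK'.trans hK.symm)
  suffices hlim : Tendsto (fun ε => fusedFormula (C + ε • (1 : CentMatrix N d))) (𝓝[>] (0 : ℝ))
      (𝓝 (K * C * Kᵀ)) by
    simpa only [fusedBound, hpd, if_false, hlim.limUnder_eq] using hleast
  have hpos : ∀ᶠ ε : ℝ in 𝓝[>] 0, 0 < ε := self_mem_nhdsWithin
  have hpdε : ∀ ε : ℝ, 0 < ε → (C + ε • (1 : CentMatrix N d)).PosDef := fun ε hε =>
    PosDef.posSemidef_add hC (PosDef.one.smul hε)
  refine tendsto_of_le_of_le (g := fun _ => K * C * Kᵀ)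
    (h := fun ε : ℝ => K * (C + ε • (1 : CentMatrix N d)) * Kᵀ) tendsto_const_nhds ?_ ?_ ?_
  · have : Continuous fun ε : ℝ => K * (C + ε • (1 : CentMatrix N d)) * Kᵀ := by fun_prop
    simpa using (this.tendsto 0).mono_left nhdsWithin_le_nhds
  · filter_upwards [hpos] with ε hε
    obtain ⟨K', hK', h⟩ := (isLeast_fusedFormula (hpdε ε hε)).1
    rw [h]
    refine (hleast.2 ⟨K', hK', rfl⟩).trans (mul_mul_transpose_le ?_ K')
    rw [Matrix.le_iff]
    simpa using (PosSemidef.one (n := Fin d × Fin N) (R := ℝ)).smul hε.le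
  · filter_upwards [hpos] with ε hε
    exact (isLeast_fusedFormula (hpdε ε hε)).2 ⟨K, hK, rfl⟩

/-! ### The centralized bound of two estimators -/

/-- The centralized matrix whose diagonal block `i` is `P i`, and whose other blocks are zero. -/
def diagPart (P : Fin N → Matrix (Fin d) (Fin d) ℝ) (i : Fin N) : CentMatrix N d :=
  Matrix.blockDiagonal (Pi.single i (P i))

theorem diagPart_apply (P : Fin N → Matrix (Fin d) (Fin d) ℝ) (i : Fin N)
    (p q : Fin d × Fin N) :
    diagPart P i p q = if p.2 = i ∧ q.2 = i then P i p.1 q.1 else 0 := by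
  obtain ⟨a, k⟩ := p
  obtain ⟨b, l⟩ := q
  rw [diagPart, blockDiagonal_apply]
  by_cases h : k = i
  · subst h
    simp [eq_comm]
  · simp [h]

theorem diagPart_posSemidef {P : Fin N → Matrix (Fin d) (Fin d) ℝ} {i : Fin N}
    (hP : (P i).PosSemidef) : (diagPart P i).PosSemidef := by
  have h : diagPart P i = (selection d i)ᵀ * P i * (selection d i)ᵀᵀ := by
    ext p q
    simp only [diagPart_apply, selection, mul_apply, transpose_apply, Matrix.of_apply,
      Matrix.one_apply]
    by_cases hp : p.2 = i <;> by_cases hq : q.2 = i <;> simp [hp, hq]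
  rw [h]
  exact posSemidef_mul_mul_transpose hP _

theorem centBound_eq_sum (P : Fin N → Matrix (Fin d) (Fin d) ℝ) (Q : CentMatrix N d)
    (ω : Fin N → ℝ) : centBound P Q ω = ∑ i, (1 / ω i) • diagPart P i + Q := by
  rw [centBound]
  congr 1
  ext p q
  rw [blockDiagonal_apply]
  simp only [Matrix.sum_apply, Matrix.smul_apply, diagPart_apply, smul_eq_mul, mul_ite, mul_zero]
  split_ifs with h
  · simp [h]
  · rw [Finset.sum_eq_zero]
    intro i _
    rw [if_neg fun h' => h (h'.1.trans h'.2.symm)]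

theorem centBound_posSemidef {P : Fin N → Matrix (Fin d) (Fin d) ℝ} {Q : CentMatrix N d}
    (hP : ∀ i, (P i).PosSemidef) (hQ : Q.PosSemidef) {ω : Fin N → ℝ} (hω : ∀ i, 0 ≤ ω i) :
    (centBound P Q ω).PosSemidef := by
  rw [centBound_eq_sum]
  exact (posSemidef_sum _ fun i _ =>
    (diagPart_posSemidef (hP i)).smul (one_div_nonneg.2 (hω i))).add hQ

theorem isLeast_esciBound_of_mem_simplexInterior [NeZero N]
    {P : Fin N → Matrix (Fin d) (Fin d) ℝ} {Q : CentMatrix N d}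
    (hP : ∀ i, (P i).PosSemidef) (hQ : Q.PosSemidef) {ω : Fin N → ℝ} (hω : ω ∈ simplexInterior N) :
    IsLeast (fusionCovariances (centBound P Q ω)) (esciBound P Q ω) := by
  rw [esciBound, if_pos hω]
  exact isLeast_fusedBound (centBound_posSemidef hP hQ hω.1.1)

/-! ### Extension to the vertices of the simplex -/

theorem mem_closure_simplexInterior [NeZero N] {ω : Fin N → ℝ} (hω : ω ∈ stdSimplex ℝ (Fin N)) :
    ω ∈ closure (simplexInterior N) := by
  have hN : (0 : ℝ) < N := by exact_mod_cast Nat.pos_of_ne_zero (NeZero.ne N)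
  have hlim : Tendsto (fun s : ℝ => fun k => (1 - s) * ω k + s * (1 / N)) (𝓝[>] 0) (𝓝 ω) := by
    have : Continuous fun s : ℝ => fun k => (1 - s) * ω k + s * (1 / N) := by fun_prop
    simpa using (this.tendsto 0).mono_left nhdsWithin_le_nhds
  refine mem_closure_of_tendsto hlim ?_
  filter_upwards [Ioo_mem_nhdsGT (zero_lt_one (α := ℝ))] with s hs
  have hpos : ∀ k, 0 < (1 - s) * ω k + s * (1 / N) := fun k =>
    add_pos_of_nonneg_of_pos (mul_nonneg (by linarith [hs.2]) (hω.1 k))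
      (mul_pos hs.1 (one_div_pos.2 hN))
  refine ⟨⟨fun k => (hpos k).le, ?_⟩, hpos⟩
  rw [Finset.sum_add_distrib, ← Finset.mul_sum, hω.2]
  simp
  field_simp
  ring

theorem centBound_two (P : Fin 2 → Matrix (Fin d) (Fin d) ℝ) (Q : CentMatrix 2 d) (ω : Fin 2 → ℝ)
    {i j : Fin 2} (hij : i ≠ j) :
    centBound P Q ω = (1 / ω i) • diagPart P i + (1 / ω j) • diagPart P j + Q := by
  have huniv : (Finset.univ : Finset (Fin 2)) = {i, j} := by
    revert i j; decide
  rw [centBound_eq_sum, huniv, Finset.sum_pair hij]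

theorem selection_mul_diagPart (P : Fin N → Matrix (Fin d) (Fin d) ℝ) {i j : Fin N}
    (hij : i ≠ j) : selection d i * diagPart P j = 0 := by
  ext a p
  rw [mul_apply]
  refine Finset.sum_eq_zero fun q _ => ?_
  rw [diagPart_apply, selection, Matrix.of_apply]
  by_cases h : q.2 = i
  · simp [h, hij]
  · simp [h]

theorem diagPart_mul_mul_diagPart_apply (P : Fin N → Matrix (Fin d) (Fin d) ℝ) {i j : Fin N}
    (hij : i ≠ j) (M : CentMatrix N d) (k : Fin N) (a b : Fin d) :
    (diagPart P i * M * diagPart P j) (a, k) (b, k) = 0 := by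
  rw [Matrix.mul_apply]
  refine Finset.sum_eq_zero fun q _ => ?_
  rw [diagPart_apply, Matrix.mul_apply, Finset.sum_mul]
  refine Finset.sum_eq_zero fun r _ => ?_
  rw [diagPart_apply]
  by_cases h : k = i
  · simp [h, hij]
  · simp [h]

theorem mul_centBound_two_mul_transpose (P : Fin 2 → Matrix (Fin d) (Fin d) ℝ) (Q : CentMatrix 2 d)
    (ω : Fin 2 → ℝ) {i j : Fin 2} (hij : i ≠ j) {K : Gain 2 d} (hK : K * diagPart P j = 0) :
    K * centBound P Q ω * Kᵀ = (1 / ω i) • (K * diagPart P i * Kᵀ) + K * Q * Kᵀ := by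
  simp [centBound_two P Q ω hij, Matrix.mul_add, Matrix.add_mul, hK]

/-- If the gain `K` satisfies `K * diagPart P j = 0`, the term of `centBound` that blows up near the
vertex `i` has no effect on `K`. -/
theorem tendsto_mul_centBound_two {P : Fin 2 → Matrix (Fin d) (Fin d) ℝ} {Q : CentMatrix 2 d}
    {ω : Fin 2 → ℝ} {i j : Fin 2} (hij : i ≠ j) (hi : ω i = 1) {K : Gain 2 d}
    (hK : K * diagPart P j = 0) :
    Tendsto (fun ω' => K * centBound P Q ω' * Kᵀ) (𝓝[simplexInterior 2] ω)
      (𝓝 (K * (diagPart P i + Q) * Kᵀ)) := by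
  simp only [mul_centBound_two_mul_transpose P Q _ hij hK, Matrix.mul_add, Matrix.add_mul]
  have h : Tendsto (fun ω' : Fin 2 → ℝ => 1 / ω' i) (𝓝[simplexInterior 2] ω) (𝓝 1) := by
    have hc : ContinuousAt (fun ω' : Fin 2 → ℝ => 1 / ω' i) ω :=
      continuousAt_const.div (continuous_apply i).continuousAt (by simp [hi])
    simpa [hi] using hc.tendsto.mono_left nhdsWithin_le_nhds
  simpa using (h.smul_const (K * diagPart P i * Kᵀ)).add_const (K * Q * Kᵀ)

/-- At a vertex of the simplex, the limit that defines `esciBound` exists. It is the least fused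
covariance among the unbiased gains for which the estimator `j`, of weight `0`, contributes none of
`P j`. -/
theorem isLeast_esciBound_vertex {P : Fin 2 → Matrix (Fin d) (Fin d) ℝ} {Q : CentMatrix 2 d}
    (hP : ∀ i, (P i).PosSemidef) (hQ : Q.PosSemidef) {ω : Fin 2 → ℝ}
    (hω : ω ∈ stdSimplex ℝ (Fin 2)) {i j : Fin 2} (hij : i ≠ j) (hi : ω i = 1) (hj : ω j = 0) :
    IsLeast {F | ∃ K : Gain 2 d, K * obs 2 d = 1 ∧ K * diagPart P j = 0 ∧
      F = K * (diagPart P i + Q) * Kᵀ} (esciBound P Q ω) := by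
  have hDi := diagPart_posSemidef (hP i)
  have hDj := diagPart_posSemidef (hP j)
  have hD := hDi.add hQ
  -- `selection d i` shows that the two constraints are compatible.
  obtain ⟨K, L, hK, hst⟩ := exists_stationary hD (fromCols (obs 2 d) (diagPart P j)) (selection d i)
  obtain ⟨hKH, hKT⟩ : K * obs 2 d = 1 ∧ K * diagPart P j = 0 := by
    rw [mul_fromCols, mul_fromCols, selection_mul_obs, selection_mul_diagPart P hij] at hK
    exact fromCols_inj hK
  suffices hlim : Tendsto (fun ω' => fusedBound (centBound P Q ω')) (𝓝[simplexInterior 2] ω)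
      (𝓝 (K * (diagPart P i + Q) * Kᵀ)) by
    have : (𝓝[simplexInterior 2] ω).NeBot :=
      mem_closure_iff_nhdsWithin_neBot.1 (mem_closure_simplexInterior hω)
    have hni : ω ∉ simplexInterior 2 := fun h => (h.2 j).ne' hj
    rw [esciBound, if_neg hni, hlim.limUnder_eq]
    refine ⟨⟨K, hKH, hKT, rfl⟩, ?_⟩
    rintro _ ⟨K', hK'H, hK'T, rfl⟩
    exact le_of_stationary hD hst (by rw [mul_fromCols, mul_fromCols, hKH, hKT, hK'H, hK'T])
  obtain ⟨L₁, M, rfl⟩ : ∃ L₁ M, L = fromRows L₁ M := ⟨_, _, (fromRows_toRows L).symm⟩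
  rw [fromCols_mul_fromRows] at hst
  have hint : ∀ᶠ ω' in 𝓝[simplexInterior 2] ω, ω' ∈ simplexInterior 2 := self_mem_nhdsWithin
  refine tendsto_of_le_of_le
    (g := fun ω' => K * (diagPart P i + Q) * Kᵀ - ω' j • (Mᵀ * diagPart P j * M)) ?_
    (tendsto_mul_centBound_two hij hi hKT) ?_ ?_
  · have hc : Continuous fun ω' : Fin 2 → ℝ =>
        K * (diagPart P i + Q) * Kᵀ - ω' j • (Mᵀ * diagPart P j * M) := by fun_prop
    simpa [hj] using (hc.tendsto ω).mono_left nhdsWithin_le_nhds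
  · filter_upwards [hint] with ω' hω'
    obtain ⟨K', hK', h⟩ :=
      (isLeast_fusedBound (centBound_posSemidef (Q := Q) hP hQ fun k => (hω'.2 k).le)).1
    rw [h]
    refine (sub_smul_le_of_stationary hD hDj hst (hK'.trans hKH.symm) hKT (hω'.2 j)).trans
      (mul_mul_transpose_le ?_ K')
    have h1 : 1 ≤ 1 / ω' i := by
      rw [le_div_iff₀ (hω'.2 i), one_mul, ← hω'.1.2]
      exact Finset.single_le_sum (fun k _ => hω'.1.1 k) (Finset.mem_univ i)
    rw [Matrix.le_iff]
    have e : centBound P Q ω' - (diagPart P i + Q + (1 / ω' j) • diagPart P j) =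
        (1 / ω' i - 1) • diagPart P i := by
      rw [centBound_two P Q ω' hij, sub_smul, one_smul]
      abel
    rw [e]
    exact hDi.smul (sub_nonneg.2 h1)
  · filter_upwards [hint] with ω' hω'
    exact (isLeast_fusedBound (centBound_posSemidef hP hQ fun k => (hω'.2 k).le)).2 ⟨K, hKH, rfl⟩

/-! ### The fused bounds are conservative -/

/-- With `w = ω₁` on the block `0` and `w = -ω₀` on the block `1`, the difference
`diag(P₀ / ω₀, P₁ / ω₁) - S` is `diag(w) S diag(w) / (ω₀ ω₁)`. -/
theorem admissible_le_centBound {P : Fin 2 → Matrix (Fin d) (Fin d) ℝ} {Q R : CentMatrix 2 d}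
    (hR : R ∈ admissible P Q) {ω : Fin 2 → ℝ} (hω : ω ∈ simplexInterior 2) :
    R ≤ centBound P Q ω := by
  obtain ⟨S, hS, hSP, rfl⟩ := hR
  have h₀ := hω.2 0
  have h₁ := hω.2 1
  have hsum : ω 0 + ω 1 = 1 := by simpa using hω.1.2
  let w : Fin d × Fin 2 → ℝ := fun p => if p.2 = 0 then ω 1 else -ω 0
  have key := (posSemidef_mul_mul_transpose hS (diagonal w)).smul
    (one_div_nonneg.2 (mul_pos h₀ h₁).le)
  rw [Matrix.le_iff]
  suffices e : centBound P Q ω - (S + Q) =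
      (1 / (ω 0 * ω 1)) • (diagonal w * S * (diagonal w)ᵀ) by rwa [e]
  rw [centBound_two P Q ω zero_ne_one, add_sub_add_right_eq_sub]
  ext ⟨a, k⟩ ⟨b, l⟩
  have hPS : ∀ i, P i a b = S (a, i) (b, i) := fun i => by rw [← hSP i, blockDiag_apply]
  simp only [Matrix.sub_apply, Matrix.add_apply, Matrix.smul_apply, diagPart_apply, hPS,
    diagonal_transpose, mul_diagonal, diagonal_mul, smul_eq_mul, w]
  have e₁ : ω 1 = 1 - ω 0 := by linarith
  rw [e₁] at h₁ ⊢
  have := h₁.ne'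
  fin_cases k <;> fin_cases l <;> simp <;> field_simp
  ring

theorem admissible_posSemidef {P : Fin N → Matrix (Fin d) (Fin d) ℝ} {Q R : CentMatrix N d}
    (hQ : Q.PosSemidef) (hR : R ∈ admissible P Q) : R.PosSemidef := by
  obtain ⟨S, hS, -, rfl⟩ := hR
  exact hS.add hQ

theorem mem_simplexInterior_or_vertex {ω : Fin 2 → ℝ} (hω : ω ∈ stdSimplex ℝ (Fin 2)) :
    ω ∈ simplexInterior 2 ∨ ∃ i j, i ≠ j ∧ ω i = 1 ∧ ω j = 0 := by
  have hsum : ω 0 + ω 1 = 1 := by simpa using hω.2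
  by_cases h₀ : ω 0 = 0
  · exact Or.inr ⟨1, 0, by decide, by linarith, h₀⟩
  by_cases h₁ : ω 1 = 0
  · exact Or.inr ⟨0, 1, by decide, by linarith, h₁⟩
  refine Or.inl ⟨hω, fun k => lt_of_le_of_ne (hω.1 k) ?_⟩
  fin_cases k
  · exact Ne.symm h₀
  · exact Ne.symm h₁

theorem esciBound_mem_conservativeBounds {P : Fin 2 → Matrix (Fin d) (Fin d) ℝ}
    {Q : CentMatrix 2 d} (hP : ∀ i, (P i).PosSemidef) (hQ : Q.PosSemidef) {ω : Fin 2 → ℝ}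
    (hω : ω ∈ stdSimplex ℝ (Fin 2)) : esciBound P Q ω ∈ conservativeBounds (admissible P Q) := by
  rcases mem_simplexInterior_or_vertex hω with hint | ⟨i, j, hij, hi, hj⟩
  · obtain ⟨K, hK, h⟩ := (isLeast_esciBound_of_mem_simplexInterior hP hQ hint).1
    rw [h]
    exact ⟨K, hK, posSemidef_mul_mul_transpose (centBound_posSemidef hP hQ hω.1) K,
      fun R hR => mul_mul_transpose_le (admissible_le_centBound hR hint) K⟩
  · obtain ⟨K, hK, hKT, h⟩ := (isLeast_esciBound_vertex hP hQ hω hij hi hj).1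
    rw [h]
    have hG := posSemidef_mul_mul_transpose ((diagPart_posSemidef (hP i)).add hQ) K
    refine ⟨K, hK, hG, fun R hR => ?_⟩
    have : (𝓝[simplexInterior 2] ω).NeBot :=
      mem_closure_iff_nhdsWithin_neBot.1 (mem_closure_simplexInterior hω)
    refine le_of_tendsto_of_le
      (posSemidef_mul_mul_transpose (admissible_posSemidef hQ hR) K).1 hG.1
      (tendsto_mul_centBound_two hij hi hKT) ?_
    filter_upwards [self_mem_nhdsWithin] with ω' hω'
    exact mul_mul_transpose_le (admissible_le_centBound hR hω') K

/-! ### Every conservative bound dominates a fused bound -/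

/-- The Cauchy–Schwarz inequality for the form of a positive semidefinite matrix. -/
theorem sq_dotProduct_mulVec_le [Fintype n] {T : Matrix n n ℝ} (hT : T.PosSemidef) (x y : n → ℝ) :
    (x ⬝ᵥ T *ᵥ y) ^ 2 ≤ (x ⬝ᵥ T *ᵥ x) * (y ⬝ᵥ T *ᵥ y) := by
  classical
  have := (Matrix.toBilin' T).apply_sq_le_of_symm
    (fun x => by simpa only [Matrix.toBilin'_apply'] using dotProduct_mulVec_self_nonneg hT x)
    ⟨fun x y => by
      simpa only [Matrix.toBilin'_apply', RingHom.id_apply] using dotProduct_mulVec_comm hT x y⟩ x y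
  simpa [Matrix.toBilin'_apply'] using this

theorem toQuadraticForm'_apply [Fintype n] [DecidableEq n] (T : Matrix n n ℝ) (x : n → ℝ) :
    T.toQuadraticForm' x = x ⬝ᵥ T *ᵥ x := by
  simp [Matrix.toQuadraticForm', Matrix.toLinearMap₂'_apply']

theorem dotProduct_mul_mul_transpose_mulVec [Fintype n] {m : Type*} [Fintype m] (K : Matrix m n ℝ)
    (R : Matrix n n ℝ) (x : m → ℝ) :
    x ⬝ᵥ (K * R * Kᵀ) *ᵥ x = (Kᵀ *ᵥ x) ⬝ᵥ R *ᵥ (Kᵀ *ᵥ x) := by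
  rw [← mulVec_mulVec, ← mulVec_mulVec, dotProduct_mulVec x K, ← mulVec_transpose]

variable {P : Fin 2 → Matrix (Fin d) (Fin d) ℝ} {Q : CentMatrix 2 d} {K : Gain 2 d}
  {B : Matrix (Fin d) (Fin d) ℝ}

/-- Admissible covariances with a rank-one cross-covariance. They correlate the component of the
first error selected by `y` with that of the second error selected by `k`. If the normalizing scalar
vanishes, its inverse is `0` and the covariance is block diagonal. -/
theorem mem_admissible_correlated (hP : ∀ i, (P i).PosSemidef) {k y : Fin d × Fin 2 → ℝ}
    (hy : y ⬝ᵥ diagPart P 0 *ᵥ y ≤ k ⬝ᵥ diagPart P 1 *ᵥ k) :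
    diagPart P 0 + diagPart P 1 + (k ⬝ᵥ diagPart P 1 *ᵥ k)⁻¹ •
      (diagPart P 0 * vecMulVec y k * diagPart P 1 + diagPart P 1 * vecMulVec k y * diagPart P 0) +
      Q ∈ admissible P Q := by
  have h₀ := diagPart_posSemidef (hP 0)
  have h₁ := diagPart_posSemidef (hP 1)
  have hs₀ : (diagPart P 0)ᵀ = diagPart P 0 := transpose_eq_of_posSemidef h₀
  have hs₁ : (diagPart P 1)ᵀ = diagPart P 1 := transpose_eq_of_posSemidef h₁
  set b := k ⬝ᵥ diagPart P 1 *ᵥ k with hb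
  refine ⟨_, ?_, ?_, rfl⟩
  · refine .of_dotProduct_mulVec_nonneg ?_ fun x => ?_
    · rw [IsHermitian, conjTranspose_eq_transpose_of_trivial]
      simp only [transpose_add, transpose_smul, transpose_mul, transpose_vecMulVec, hs₀, hs₁,
        Matrix.mul_assoc]
      congr 2
      abel
    have hx : x ⬝ᵥ (diagPart P 0 + diagPart P 1 + b⁻¹ •
        (diagPart P 0 * vecMulVec y k * diagPart P 1 +
          diagPart P 1 * vecMulVec k y * diagPart P 0)) *ᵥ x =
        x ⬝ᵥ diagPart P 0 *ᵥ x + x ⬝ᵥ diagPart P 1 *ᵥ x +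
          2 * b⁻¹ * (x ⬝ᵥ diagPart P 0 *ᵥ y) * (x ⬝ᵥ diagPart P 1 *ᵥ k) := by
      simp only [add_mulVec, smul_mulVec, ← mulVec_mulVec, vecMulVec_mulVec, mulVec_smul,
        dotProduct_add, dotProduct_smul, dotProduct_mulVec_comm h₀ y x,
        dotProduct_mulVec_comm h₁ k x, smul_eq_mul, op_smul_eq_smul]
      ring
    have hb0 : 0 ≤ b := dotProduct_mulVec_self_nonneg h₁ k
    have hx0 : 0 ≤ x ⬝ᵥ diagPart P 0 *ᵥ x := dotProduct_mulVec_self_nonneg h₀ x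
    have hx1 : 0 ≤ x ⬝ᵥ diagPart P 1 *ᵥ x := dotProduct_mulVec_self_nonneg h₁ x
    rw [star_trivial, hx]
    rcases hb0.eq_or_lt with hb0 | hb0
    · rw [← hb0]
      simpa using add_nonneg hx0 hx1
    · have c₀ := (sq_dotProduct_mulVec_le h₀ x y).trans (mul_le_mul_of_nonneg_left hy hx0)
      have c₁ := sq_dotProduct_mulVec_le h₁ x k
      rw [← hb] at c₁
      rw [← div_le_iff₀ hb0] at c₀ c₁
      set u := x ⬝ᵥ diagPart P 0 *ᵥ y
      set v := x ⬝ᵥ diagPart P 1 *ᵥ k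
      have : 0 ≤ u ^ 2 / b + v ^ 2 / b + 2 * b⁻¹ * u * v := by
        have : u ^ 2 / b + v ^ 2 / b + 2 * b⁻¹ * u * v = (u + v) ^ 2 / b := by
          field_simp; ring
        rw [this]; positivity
      linarith
  · intro i
    ext a c
    simp only [blockDiag_apply, Matrix.add_apply, Matrix.smul_apply, diagPart_apply,
      diagPart_mul_mul_diagPart_apply P zero_ne_one, diagPart_mul_mul_diagPart_apply P one_ne_zero]
    fin_cases i <;> simp

/-- Testing a conservative bound on the covariances of `mem_admissible_correlated` bounds a
quadratic form in `(x, y)` on the set where another one is nonnegative, which is the hypothesis of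
the S-lemma. -/
theorem dotProduct_mulVec_le_of_isConservative (hP : ∀ i, (P i).PosSemidef)
    (h : IsConservative (admissible P Q) K B) (x : Fin d → ℝ) {k y : Fin d × Fin 2 → ℝ}
    (hk : k = Kᵀ *ᵥ x) (hy : y ⬝ᵥ diagPart P 0 *ᵥ y ≤ k ⬝ᵥ diagPart P 1 *ᵥ k) :
    k ⬝ᵥ diagPart P 0 *ᵥ k + k ⬝ᵥ diagPart P 1 *ᵥ k + k ⬝ᵥ Q *ᵥ k + 2 * (k ⬝ᵥ diagPart P 0 *ᵥ y) ≤
      x ⬝ᵥ B *ᵥ x := by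
  have h₀ := diagPart_posSemidef (hP 0)
  have h₁ := diagPart_posSemidef (hP 1)
  have hle := dotProduct_mulVec_self_nonneg
    (Matrix.le_iff.1 (h.le _ (mem_admissible_correlated (Q := Q) hP hy))) x
  rw [sub_mulVec, dotProduct_sub, sub_nonneg, dotProduct_mul_mul_transpose_mulVec,
    ← hk] at hle
  simp only [add_mulVec, smul_mulVec, ← mulVec_mulVec, vecMulVec_mulVec, mulVec_smul,
    dotProduct_add, dotProduct_smul, dotProduct_mulVec_comm h₀ y k, smul_eq_mul,
    op_smul_eq_smul] at hle
  set b := k ⬝ᵥ diagPart P 1 *ᵥ k with hb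
  have hb0 : 0 ≤ b := dotProduct_mulVec_self_nonneg h₁ k
  rcases hb0.eq_or_lt with hb0 | hb0
  -- The covariance is block diagonal, but the cross term vanishes as well.
  · have hy0 : k ⬝ᵥ diagPart P 0 *ᵥ y = 0 := by
      have h2 := sq_dotProduct_mulVec_le h₀ k y
      have h3 : 0 ≤ y ⬝ᵥ diagPart P 0 *ᵥ y := dotProduct_mulVec_self_nonneg h₀ y
      have h4 : y ⬝ᵥ diagPart P 0 *ᵥ y = 0 := le_antisymm (hy.trans hb0.ge) h3
      rw [h4, mul_zero] at h2
      exact pow_eq_zero_iff two_ne_zero |>.1 (le_antisymm h2 (sq_nonneg _))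
    rw [hy0] at hle ⊢
    simp only [mul_zero, zero_mul, add_zero] at hle ⊢
    exact hle
  · field_simp at hle
    linarith

theorem mul_eq_zero_of_forall_dotProduct_eq_zero {T : CentMatrix 2 d} (hT : T.PosSemidef)
    (h : ∀ x, (Kᵀ *ᵥ x) ⬝ᵥ T *ᵥ (Kᵀ *ᵥ x) = 0) : K * T = 0 := by
  have hTs : Tᵀ = T := transpose_eq_of_posSemidef hT
  have h₁ : T * Kᵀ = 0 := by
    refine Matrix.ext_of_mulVec_single fun i => ?_
    rw [← mulVec_mulVec, zero_mulVec]
    exact (hT.dotProduct_mulVec_zero_iff _).1 (by simpa using h (Pi.single i 1))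
  have := congrArg Matrix.transpose h₁
  simpa [Matrix.transpose_mul, hTs] using this

/-- If the gain is insensitive to `P j`, the bound of the vertex `i` is dominated: it suffices to
test the block diagonal admissible covariance. -/
theorem exists_esciBound_le_of_mul_eq_zero (hP : ∀ i, (P i).PosSemidef) (hQ : Q.PosSemidef)
    (h : IsConservative (admissible P Q) K B) {i j : Fin 2} (hij : i ≠ j)
    (hK : K * diagPart P j = 0) : ∃ ω ∈ stdSimplex ℝ (Fin 2), esciBound P Q ω ≤ B := by
  refine ⟨Pi.single i 1, single_mem_stdSimplex ℝ i, ?_⟩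
  refine ((isLeast_esciBound_vertex hP hQ (single_mem_stdSimplex ℝ i) hij (by simp)
    (by simp [hij.symm])).2 ⟨K, h.unbiased, hK, rfl⟩).trans ?_
  have hmem : diagPart P i + diagPart P j + Q ∈ admissible P Q := by
    refine ⟨_, (diagPart_posSemidef (hP i)).add (diagPart_posSemidef (hP j)), fun k => ?_, rfl⟩
    ext a c
    rw [blockDiag_apply, Matrix.add_apply, diagPart_apply, diagPart_apply]
    have : k = i ∨ k = j := by omega
    rcases this with rfl | rfl
    · simp [hij]
    · simp [hij.symm]
  have := h.le _ hmem
  simpa [Matrix.mul_add, hK] using this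

/-- Every conservative bound dominates the fused bound of some weights. Unless one of the blocks is
invisible to the gain, the weights are `(μ, 1) / (1 + μ)`, where `μ` is the multiplier of the
S-lemma. -/
theorem exists_esciBound_le (hP : ∀ i, (P i).PosSemidef) (hQ : Q.PosSemidef)
    (h : IsConservative (admissible P Q) K B) :
    ∃ ω ∈ stdSimplex ℝ (Fin 2), esciBound P Q ω ≤ B := by
  by_cases hK₁ : K * diagPart P 1 = 0
  · exact exists_esciBound_le_of_mul_eq_zero hP hQ h zero_ne_one hK₁
  by_cases hK₀ : K * diagPart P 0 = 0
  · exact exists_esciBound_le_of_mul_eq_zero hP hQ h one_ne_zero hK₀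
  have h₀ := diagPart_posSemidef (hP 0)
  have h₁ := diagPart_posSemidef (hP 1)
  let κ : (Fin d → ℝ) × (Fin d × Fin 2 → ℝ) →ₗ[ℝ] (Fin d × Fin 2 → ℝ) :=
    Kᵀ.mulVecLin ∘ₗ LinearMap.fst ℝ _ _
  let σ : (Fin d → ℝ) × (Fin d × Fin 2 → ℝ) →ₗ[ℝ] (Fin d × Fin 2 → ℝ) := LinearMap.snd ℝ _ _
  let q₁ : QuadraticForm ℝ ((Fin d → ℝ) × (Fin d × Fin 2 → ℝ)) :=
    (diagPart P 1 + Q).toQuadraticForm'.comp κ - B.toQuadraticForm'.comp (LinearMap.fst ℝ _ _) +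
      (diagPart P 0).toQuadraticForm'.comp (κ + σ) - (diagPart P 0).toQuadraticForm'.comp σ
  let q₂ : QuadraticForm ℝ ((Fin d → ℝ) × (Fin d × Fin 2 → ℝ)) :=
    (diagPart P 1).toQuadraticForm'.comp κ - (diagPart P 0).toQuadraticForm'.comp σ
  have hq₁ : ∀ x y, q₁ (x, y) = (Kᵀ *ᵥ x) ⬝ᵥ diagPart P 0 *ᵥ (Kᵀ *ᵥ x) +
      (Kᵀ *ᵥ x) ⬝ᵥ diagPart P 1 *ᵥ (Kᵀ *ᵥ x) + (Kᵀ *ᵥ x) ⬝ᵥ Q *ᵥ (Kᵀ *ᵥ x) +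
      2 * ((Kᵀ *ᵥ x) ⬝ᵥ diagPart P 0 *ᵥ y) - x ⬝ᵥ B *ᵥ x := by
    intro x y
    simp only [q₁, κ, σ, _root_.sub_apply, _root_.add_apply, QuadraticMap.comp_apply,
      toQuadraticForm'_apply, LinearMap.comp_apply, LinearMap.fst_apply, LinearMap.snd_apply,
      LinearMap.add_apply, mulVecLin_apply, add_mulVec, mulVec_add, dotProduct_add,
      add_dotProduct, dotProduct_mulVec_comm h₀ y]
    ring
  have hq₂ : ∀ x y, q₂ (x, y) =
      (Kᵀ *ᵥ x) ⬝ᵥ diagPart P 1 *ᵥ (Kᵀ *ᵥ x) - y ⬝ᵥ diagPart P 0 *ᵥ y := by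
    intro x y
    simp only [q₂, κ, σ, _root_.sub_apply, QuadraticMap.comp_apply,
      toQuadraticForm'_apply, LinearMap.comp_apply, LinearMap.fst_apply, LinearMap.snd_apply,
      mulVecLin_apply]
  have hpos : ∃ z, 0 < q₂ z := by
    by_contra! hneg
    refine hK₁ (mul_eq_zero_of_forall_dotProduct_eq_zero h₁ fun x => le_antisymm ?_ ?_)
    · simpa [hq₂] using hneg (x, 0)
    · exact dotProduct_mulVec_self_nonneg h₁ _
  obtain ⟨μ, hμ, hle⟩ := exists_nonneg_add_mul_nonpos q₁ q₂ (by
    rintro ⟨x, y⟩ hxy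
    rw [hq₂, sub_nonneg] at hxy
    have := dotProduct_mulVec_le_of_isConservative hP h x rfl hxy
    rw [hq₁]
    linarith) hpos
  have hμ0 : 0 < μ := by
    -- For `μ = 0`, the form `q₁`, which is affine in `y`, would be nonpositive for all `y`.
    refine lt_of_le_of_ne hμ fun hμ' => hK₀ ?_
    refine mul_eq_zero_of_forall_dotProduct_eq_zero h₀ fun x => ?_
    set a := (Kᵀ *ᵥ x) ⬝ᵥ diagPart P 0 *ᵥ (Kᵀ *ᵥ x) with ha
    have ha0 : 0 ≤ a := dotProduct_mulVec_self_nonneg h₀ (Kᵀ *ᵥ x)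
    by_contra hne
    have ha1 : 0 < a := lt_of_le_of_ne ha0 (Ne.symm hne)
    set c := a + (Kᵀ *ᵥ x) ⬝ᵥ diagPart P 1 *ᵥ (Kᵀ *ᵥ x) + (Kᵀ *ᵥ x) ⬝ᵥ Q *ᵥ (Kᵀ *ᵥ x) -
      x ⬝ᵥ B *ᵥ x with hc
    have := hle (x, ((1 - c) / (2 * a)) • (Kᵀ *ᵥ x))
    rw [hq₁, ← hμ', zero_mul, mulVec_smul, dotProduct_smul, ← ha, smul_eq_mul] at this
    have e : 2 * ((1 - c) / (2 * a) * a) = 1 - c := by field_simp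
    linarith
  let ω : Fin 2 → ℝ := ![μ / (1 + μ), 1 / (1 + μ)]
  have hω₀ : ω 0 = μ / (1 + μ) := rfl
  have hω₁ : ω 1 = 1 / (1 + μ) := rfl
  have hωpos : ∀ k, 0 < ω k := by
    intro k
    fin_cases k
    · change 0 < μ / (1 + μ); positivity
    · change 0 < 1 / (1 + μ); positivity
  have hωS : ω ∈ stdSimplex ℝ (Fin 2) := by
    refine ⟨fun k => (hωpos k).le, ?_⟩
    rw [Fin.sum_univ_two, hω₀, hω₁]
    field_simp
    ring
  have hωI : ω ∈ simplexInterior 2 := ⟨hωS, hωpos⟩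
  refine ⟨ω, hωS, ((isLeast_esciBound_of_mem_simplexInterior hP hQ hωI).2
    ⟨K, h.unbiased, rfl⟩).trans ?_⟩
  refine (le_iff_dotProduct_mulVec_le
    (posSemidef_mul_mul_transpose (centBound_posSemidef hP hQ hωS.1) K).1 h.posSemidef.1).2
    fun x => ?_
  rw [dotProduct_mul_mul_transpose_mulVec, centBound_two P Q ω zero_ne_one]
  -- This `y` maximizes `q₁ (x, y) + μ q₂ (x, y)`.
  have := hle (x, μ⁻¹ • (Kᵀ *ᵥ x))
  rw [hq₁, hq₂] at this
  simp only [mulVec_smul, dotProduct_smul, smul_dotProduct, smul_eq_mul] at this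
  simp only [add_mulVec, smul_mulVec, dotProduct_add, dotProduct_smul, smul_eq_mul, hω₀, hω₁]
  set a := (Kᵀ *ᵥ x) ⬝ᵥ diagPart P 0 *ᵥ (Kᵀ *ᵥ x)
  have e₁ : 1 / (μ / (1 + μ)) * a = a + μ⁻¹ * a := by field_simp; ring
  have e₂ : 1 / (1 / (1 + μ)) = 1 + μ := by field_simp
  have e₃ : μ * (μ⁻¹ * (μ⁻¹ * a)) = μ⁻¹ * a := by field_simp
  rw [e₁, e₂]
  linarith

end ESCI

theorem theorem1 (d : ℕ)
    (P : Fin 2 → Matrix (Fin d) (Fin d) ℝ) (hP : ∀ i, (P i).PosSemidef)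
    (Q : ESCI.CentMatrix 2 d) (hQ : Q.PosSemidef)
    (J : Matrix (Fin d) (Fin d) ℝ → ℝ)
    (hJ : StrictMonoOn J (ESCI.conservativeBounds (ESCI.admissible P Q)))
    (K : ESCI.Gain 2 d) (B : Matrix (Fin d) (Fin d) ℝ)
    (hKB : ESCI.IsConservative (ESCI.admissible P Q) K B) :
    ESCI.IsOptimal J (ESCI.admissible P Q) K B ↔
      ∃ ω ∈ stdSimplex ℝ (Fin 2),
        IsMinOn (fun ω' => J (ESCI.esciBound P Q ω')) (stdSimplex ℝ (Fin 2)) ω ∧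
          B = ESCI.esciBound P Q ω := by
  have hmem : ∀ ω ∈ stdSimplex ℝ (Fin 2),
      ESCI.esciBound P Q ω ∈ ESCI.conservativeBounds (ESCI.admissible P Q) :=
    fun ω hω => ESCI.esciBound_mem_conservativeBounds hP hQ hω
  constructor
  · rintro ⟨-, hopt⟩
    obtain ⟨ω, hω, hle⟩ := ESCI.exists_esciBound_le hP hQ hKB
    have hB : B = ESCI.esciBound P Q ω := by
      obtain ⟨K', hK'⟩ := hmem ω hω
      by_contra hne
      exact (hJ ⟨K', hK'⟩ ⟨K, hKB⟩ (lt_of_le_of_ne hle (Ne.symm hne))).not_ge (hopt K' _ hK')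
    refine ⟨ω, hω, fun ω' hω' => ?_, hB⟩
    obtain ⟨K', hK'⟩ := hmem ω' hω'
    change J (ESCI.esciBound P Q ω) ≤ _
    rw [← hB]
    exact hopt K' _ hK'
  · rintro ⟨ω, hω, hmin, rfl⟩
    refine ⟨hKB, fun K' B' hK' => ?_⟩
    obtain ⟨ω', hω', hle⟩ := ESCI.exists_esciBound_le hP hQ hK'
    exact (hmin hω').trans (hJ.monotoneOn (hmem ω' hω') ⟨K', hK'⟩ hle)
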